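/- Let $1\le k\le n$ and $x\in\mathbb R$. Let $T=(V,E)$ be a tree on $V=\{1,\dots,n\}$ with a designated root $r$ (for instance $r=1$) and a fixed ordering of the nodes; $E$ is the set of arcs $(i,j)$ directed away from the root ($i$ the parent of $j$). For a node $i$ let $d_i$ be its number of children, $i(1),\dots,i(d_i)$ its children in the fixed order, and $N(i,s)$ the number of nodes of the tree consisting of $i$ and the full subtrees below $i(1),\dots,i(s)$. Suppose real numbers $p_i$ $(i\in V)$ and $p_{ij}$ $((i,j)\in E)$ are given that are consistent: each $p_i$ is $P(Y\le x)$ for some real random variable $Y$, and for each $(i,j)\in E$ there is a pair $(Y,Z)$ of real random variables with $P(Y\le x)=p_i$, $P(Z\le x)=p_j$, $P(Y\le x,Z\le x)=p_{ij}$. Let $\Theta_x$ be the set of all probability distributions $\theta$ of $\tilde X=(\tilde X_1,\dots,\tilde X_n)$ on $\mathbb R^n$ with $P_\theta(\tilde X_i\le x)=p_i$ for all $i\in V$ and $P_\theta(\tilde X_i\le x,\tilde X_j\le x)=p_{ij}$ for all $(i,j)\in E$, and let $\tilde X_{k:n}$ be the $k$-th smallest of $\tilde X_1,\dots,\tilde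 X_n$. Consider the linear program in the real variables $\lambda$, $z$, $\alpha_i,\tau_i$ $(i\in V)$, $\beta_{ij},\Delta_{ij},\eta_{ij},\gamma_{ij},\chi_{ij}$ $((i,j)\in E)$ and $x_{i,s,y,t}$ ($y\in\{0,1\}$), where $[a,b]$ denotes the set of integers from $a$ to $b$: $$\min\ \lambda+\sum_{i=1}^n\alpha_ip_i+\sum_{(i,j)\in E}\beta_{ij}p_{ij}$$ subject to - $\lambda-\sum_{(i,j)\in E}(\Delta_{ij}+\chi_{ij})-\sum_{i}\tau_i\ge0$; - $\sum_{j:(i,j)\in E}(\Delta_{ij}-\eta_{ij})+\sum_{j:(j,i)\in E}(\Delta_{ji}-\gamma_{ji})+\tau_i+\alpha_i\ge0$ for $i\in V$; - $\eta_{ij}+\gamma_{ij}-\Delta_{ij}+\chi_{ij}+\beta_{ij}\ge0$ for $(i,j)\in E$; and $\eta,\gamma,\Delta,\tau,\chi\ge0$; - $\lambda+z\ge1$; $x_{r,d_r,0,t}\ge z$ and $x_{r,d_r,1,t}\ge z$ for $t\in[k,n]$; - $x_{i,s,0,0}=0$ and $x_{i,s,1,1}=\alpha_i$ for $i\in V$,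 $s\in[0,d_i]$; - for each $i$ with $d_i\ge1$, writing $c=i(1)$: $x_{i,1,0,t}\le x_{c,d_c,0,t}$ for $t\in[0,N(i,1)-2]$; $x_{i,1,0,t}\le x_{c,d_c,1,t}$ for $t\in[1,N(i,1)-1]$; $x_{i,1,1,t}\le x_{c,d_c,0,t-1}+\alpha_i$ for $t\in[1,N(i,1)-1]$; $x_{i,1,1,t}\le x_{c,d_c,1,t-1}+\alpha_i+\beta_{ic}$ for $t\in[2,N(i,1)]$; - for each $i$ with $d_i\ge2$ and $s\in[2,d_i]$, writing $c=i(s)$, $M=N(i,s-1)$, $K=N(c,d_c)$: $x_{i,s,0,t}\le x_{i,s-1,0,t-a}+x_{c,d_c,0,a}$ for $t\in[0,N(i,s)-2]$, $a\in[\max(0,t-(M-1)),\min(K-1,t)]$; $x_{i,s,0,t}\le x_{i,s-1,0,t-a}+x_{c,d_c,1,a}$ for $t\in[1,N(i,s)-1]$, $a\in[\max(1,t-(M-1)),\min(K,t)]$; $x_{i,s,1,t}\le x_{i,s-1,1,t-a}+x_{c,d_c,0,a}$ for $t\in[1,N(i,s)-1]$, $a\in[\max(0,t-M),\min(K-1,t-1)]$;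 $x_{i,s,1,t}\le x_{i,s-1,1,t-a}+x_{c,d_c,1,a}+\beta_{ic}$ for $t\in[2,N(i,s)]$, $a\in[\max(1,t-M),\min(K,t-1)]$. Then the minimum of this linear program and the maximum $\max_{\theta\in\Theta_x}P_\theta(\tilde X_{k:n}\le x)$ are both attained, and they are equal. -/

import Mathlib

open MeasureTheory

namespace TreeBound

/-- A tree graph on the nodes `Fin n`, with a designated root and an arbitrary but fixed ordering
of the nodes (`order s` is the node in position `s`). -/
structure OrderedTree (n : ℕ) where
  graph : SimpleGraph (Fin n)
  isTree : graph.IsTree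
  root : Fin n
  order : Equiv.Perm (Fin n)

namespace OrderedTree

variable {n : ℕ} (T : OrderedTree n)

/-- `(i, j)` is an arc of the tree directed away from the root: `i` is the parent of `j`. -/
def Arc (i j : Fin n) : Prop :=
  T.graph.Adj i j ∧ T.graph.dist T.root j = T.graph.dist T.root i + 1

open Classical in
/-- The set `E` of arcs (parent, child); it contains each edge of the tree exactly once. -/
noncomputable def arcs : Finset (Fin n × Fin n) :=
  Finset.univ.filter fun e => T.Arc e.1 e.2

open Classical in
/-- The children of `i`, listed according to the fixed ordering. -/
noncomputable def children (i : Fin n) : List (Fin n) :=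
  (List.ofFn T.order).filter fun j => decide (T.Arc i j)

/-- The out-degree `d_i`. -/
noncomputable def deg (i : Fin n) : ℕ := (T.children i).length

/-- The `s`-th child `i(s)`, for `1 ≤ s ≤ d_i` (the value outside this range is never used). -/
noncomputable def child (i : Fin n) (s : ℕ) : Fin n := (T.children i).getD (s - 1) i

open Classical in
/-- `V(i, s)`: the node `i` together with the full subtrees below its first `s` children. -/
noncomputable def nodes (i : Fin n) (s : ℕ) : Finset (Fin n) :=
  Finset.univ.filter fun v =>
    v = i ∨ ∃ c ∈ (T.children i).take s, Relation.ReflTransGen T.Arc c v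

/-- `N(i, s)`, the number of nodes in `V(i, s)`. -/
noncomputable def size (i : Fin n) (s : ℕ) : ℕ := (T.nodes i s).card

end OrderedTree

/-- The decision variables of the linear program. Doubly indexed variables are only used at the
arcs of the tree; `x i s y t` is only used at the indices that occur in the constraints. -/
structure LPVars (n : ℕ) where
  lam : ℝ
  z : ℝ
  α : Fin n → ℝ
  τ : Fin n → ℝ
  β : Fin n → Fin n → ℝ
  Δ : Fin n → Fin n → ℝ
  η : Fin n → Fin n → ℝ
  γ : Fin n → Fin n → ℝ
  χ : Fin n → Fin n → ℝ
  x : Fin n → ℕ → Fin 2 → ℕ → ℝ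

namespace LPVars

variable {n : ℕ}

/-- The objective function, for univariate probabilities `p` and bivariate probabilities `q`. -/
noncomputable def objective (T : OrderedTree n) (p : Fin n → ℝ) (q : Fin n → Fin n → ℝ)
    (v : LPVars n) : ℝ :=
  v.lam + ∑ i, v.α i * p i + ∑ e ∈ T.arcs, v.β e.1 e.2 * q e.1 e.2

open Classical in
/-- The constraints of the linear program. Natural-number subtraction is never truncated here,
except in the lower ends of ranges `max 0 (t - _)`, `max 1 (t - _)`, where it changes nothing. -/
structure Feasible (T : OrderedTree n) (k : ℕ) (v : LPVars n) : Prop where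
  nonneg : ∀ i j, T.Arc i j →
    0 ≤ v.η i j ∧ 0 ≤ v.γ i j ∧ 0 ≤ v.Δ i j ∧ 0 ≤ v.χ i j
  nonneg_τ : ∀ i, 0 ≤ v.τ i
  const_row : v.lam - ∑ e ∈ T.arcs, (v.Δ e.1 e.2 + v.χ e.1 e.2) - ∑ i, v.τ i ≥ 0
  node_row : ∀ i,
    ∑ j with T.Arc i j, (v.Δ i j - v.η i j) + ∑ j with T.Arc j i, (v.Δ j i - v.γ j i)
      + v.τ i + v.α i ≥ 0
  arc_row : ∀ i j, T.Arc i j → v.η i j + v.γ i j - v.Δ i j + v.χ i j + v.β i j ≥ 0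
  lam_z : v.lam + v.z ≥ 1
  root_zero : ∀ t ∈ Finset.Icc k n, v.x T.root (T.deg T.root) 0 t - v.z ≥ 0
  root_one : ∀ t ∈ Finset.Icc k n, v.x T.root (T.deg T.root) 1 t - v.z ≥ 0
  base_zero : ∀ i, ∀ s ∈ Finset.Icc 0 (T.deg i), v.x i s 0 0 = 0
  base_one : ∀ i, ∀ s ∈ Finset.Icc 0 (T.deg i), v.x i s 1 1 - v.α i = 0
  first_00 : ∀ i, 1 ≤ T.deg i → ∀ t ∈ Finset.Icc 0 (T.size i 1 - 2),
    v.x (T.child i 1) (T.deg (T.child i 1)) 0 t - v.x i 1 0 t ≥ 0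
  first_01 : ∀ i, 1 ≤ T.deg i → ∀ t ∈ Finset.Icc 1 (T.size i 1 - 1),
    v.x (T.child i 1) (T.deg (T.child i 1)) 1 t - v.x i 1 0 t ≥ 0
  first_10 : ∀ i, 1 ≤ T.deg i → ∀ t ∈ Finset.Icc 1 (T.size i 1 - 1),
    v.x (T.child i 1) (T.deg (T.child i 1)) 0 (t - 1) - v.x i 1 1 t + v.α i ≥ 0
  first_11 : ∀ i, 1 ≤ T.deg i → ∀ t ∈ Finset.Icc 2 (T.size i 1),
    v.x (T.child i 1) (T.deg (T.child i 1)) 1 (t - 1) - v.x i 1 1 t + v.α i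
      + v.β i (T.child i 1) ≥ 0
  next_00 : ∀ i, 2 ≤ T.deg i → ∀ s ∈ Finset.Icc 2 (T.deg i),
    ∀ t ∈ Finset.Icc 0 (T.size i s - 2),
    ∀ a ∈ Finset.Icc (max 0 (t - (T.size i (s - 1) - 1)))
        (min (T.size (T.child i s) (T.deg (T.child i s)) - 1) t),
      v.x i (s - 1) 0 (t - a) + v.x (T.child i s) (T.deg (T.child i s)) 0 a - v.x i s 0 t ≥ 0
  next_01 : ∀ i, 2 ≤ T.deg i → ∀ s ∈ Finset.Icc 2 (T.deg i),
    ∀ t ∈ Finset.Icc 1 (T.size i s - 1),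
    ∀ a ∈ Finset.Icc (max 1 (t - (T.size i (s - 1) - 1)))
        (min (T.size (T.child i s) (T.deg (T.child i s))) t),
      v.x i (s - 1) 0 (t - a) + v.x (T.child i s) (T.deg (T.child i s)) 1 a - v.x i s 0 t ≥ 0
  next_10 : ∀ i, 2 ≤ T.deg i → ∀ s ∈ Finset.Icc 2 (T.deg i),
    ∀ t ∈ Finset.Icc 1 (T.size i s - 1),
    ∀ a ∈ Finset.Icc (max 0 (t - T.size i (s - 1)))
        (min (T.size (T.child i s) (T.deg (T.child i s)) - 1) (t - 1)),
      v.x i (s - 1) 1 (t - a) + v.x (T.child i s) (T.deg (T.child i s)) 0 a - v.x i s 1 t ≥ 0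
  next_11 : ∀ i, 2 ≤ T.deg i → ∀ s ∈ Finset.Icc 2 (T.deg i),
    ∀ t ∈ Finset.Icc 2 (T.size i s),
    ∀ a ∈ Finset.Icc (max 1 (t - T.size i (s - 1)))
        (min (T.size (T.child i s) (T.deg (T.child i s))) (t - 1)),
      v.x i (s - 1) 1 (t - a) + v.x (T.child i s) (T.deg (T.child i s)) 1 a - v.x i s 1 t
        + v.β i (T.child i s) ≥ 0

end LPVars

/-- `U` is the optimal value (an attained minimum) of the linear program. -/
def IsLPValue {n : ℕ} (T : OrderedTree n) (k : ℕ) (p : Fin n → ℝ) (q : Fin n → Fin n → ℝ)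
    (U : ℝ) : Prop :=
  IsLeast {r | ∃ v : LPVars n, v.Feasible T k ∧ v.objective T p q = r} U

/-- The `k`-th order statistic (`k`-th smallest entry, `1 ≤ k ≤ n`) of the vector `X`. -/
noncomputable def orderStat {n : ℕ} (k : ℕ) (hk : 1 ≤ k) (hkn : k ≤ n) (X : Fin n → ℝ) : ℝ :=
  X (Tuple.sort X ⟨k - 1, by omega⟩)

/-- `Θ_x`: the joint distributions of `n` real random variables with `P(X_i ≤ x) = p i` for every
node and `P(X_i ≤ x, X_j ≤ x) = q i j` for every arc of the tree. -/
def jointDistributions {n : ℕ} (T : OrderedTree n) (x : ℝ) (p : Fin n → ℝ)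
    (q : Fin n → Fin n → ℝ) : Set (Measure (Fin n → ℝ)) :=
  {θ | IsProbabilityMeasure θ ∧
    (∀ i j, T.Arc i j → θ.real {X | X i ≤ x ∧ X j ≤ x} = q i j) ∧
    ∀ i, θ.real {X | X i ≤ x} = p i}

/-- The prescribed data are (pairwise) consistent: each `p i` is the value at `x` of the cdf of a
real random variable, and for each arc `(i, j)` there is a pair of real random variables whose
univariate and joint cdfs at `x` are `p i`, `p j` and `q i j`. -/
def Consistent {n : ℕ} (T : OrderedTree n) (x : ℝ) (p : Fin n → ℝ)
    (q : Fin n → Fin n → ℝ) : Prop :=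
  (∀ i, ∃ μ : Measure ℝ, IsProbabilityMeasure μ ∧ μ.real {a | a ≤ x} = p i) ∧
  ∀ i j, T.Arc i j → ∃ μ : Measure (ℝ × ℝ), IsProbabilityMeasure μ ∧
    μ.real {a | a.1 ≤ x} = p i ∧ μ.real {a | a.2 ≤ x} = p j ∧
    μ.real {a | a.1 ≤ x ∧ a.2 ≤ x} = q i j

end TreeBound

/-!
The proof is linear programming duality over the `0`-`1` configurations `c` of the nodes, where
`c i = 1` records the event `X i ≤ x`.

Only the law of the configuration matters for `Θ_x`, so the maximum is that of a linear functional
over the weights on configurations with prescribed moments `E c_i = p_i` and `E c_i c_j = q_ij`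
(`jointDistributions_values`). Its dual asks for `(l, α, β)` of least value
`l + ∑ α_i p_i + ∑ β_ij q_ij` such that `l + ∑ α_i c_i + ∑ β_ij c_i c_j` is at least the indicator
of `c` having at least `k` ones. Strong duality with attainment on both sides (`moment_duality`)
follows from Farkas' lemma and compactness of the simplex. It remains to see that `(l, α, β)` is
dual feasible if and only if it extends to a feasible solution of the linear program of the
statement. The exponentially many dual constraints split into two families.

* Nonnegativity for all `c`. Minimizing the energy `∑ α_i c_i + ∑ β_ij c_i c_j` by passing messages
  from the leaves to the root writes `l` plus the energy as a sum of nonnegative functions of the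
  pairs `(c_i, c_j)` on the arcs and of a nonnegative function of the value at the root. The values
  of these functions are the multipliers `τ, Δ, η, γ` (`exists_certificate`, where `χ = 0`
  suffices). Conversely, the multiplier rows give nonnegativity of `l + ∑ α_i p_i + ∑ β_ij q_ij` for
  all locally consistent data (`IsCertificate.nonneg_energy`), in particular for the data of a
  configuration.
* The lower bound `1` for all `c` with at least `k` ones. The remaining rows say that `x i s y t` is
  a lower bound for the energy on the partial subtree `V(i, s)` over the configurations with value
  `y` at `i` and `t` ones (`LPVars.Feasible.x_le_partialEnergy`), and the exact minima satisfy these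
  rows, since configurations on disjoint subtrees can be glued (`dpValue_step`).

The first family also shows that `Θ_x` is nonempty: if a form `l + ∑ α_i c_i + ∑ β_ij c_i c_j` is
nonnegative on all configurations, then it is nonnegative at the consistent data `(p, q)`, so
Farkas' lemma applies (`momentWeights_nonempty`).
-/

namespace TreeBound

/-! ### Farkas' lemma and duality for moment problems -/

/-- Farkas' lemma for finitely many linear functionals, by induction on their number; no topology
or finite-dimensionality is needed. -/
theorem farkas {V : Type*} [AddCommGroup V] [Module ℝ V] {m : ℕ} (f : Fin m → Module.Dual ℝ V)
    (g : Module.Dual ℝ V) (h : ∀ v, (∀ i, f i v ≤ 0) → g v ≤ 0) :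
    ∃ w : Fin m → ℝ, (∀ i, 0 ≤ w i) ∧ g = ∑ i, w i • f i := by
  induction m generalizing g with
  | zero =>
    refine ⟨0, fun i => i.elim0, ?_⟩
    ext v
    have h1 := h v fun i => i.elim0
    have h2 := h (-v) fun i => i.elim0
    simp only [map_neg] at h2
    simpa using le_antisymm h1 (by linarith)
  | succ m ih =>
    by_cases hy : ∀ v, (∀ i : Fin m, f i.castSucc v ≤ 0) → g v ≤ 0
    · obtain ⟨w, hw, hg⟩ := ih (fun i => f i.castSucc) g hy
      refine ⟨Fin.snoc w 0, fun i => ?_, ?_⟩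
      · induction i using Fin.lastCases <;> simp [hw]
      · simp [Fin.sum_univ_castSucc, hg]
    · push Not at hy
      obtain ⟨y, hfy, hgy⟩ := hy
      set l := f (Fin.last m) with hl
      have hly : 0 < l y := by
        by_contra! hle
        refine absurd (h y fun i => ?_) hgy.not_ge
        induction i using Fin.lastCases with
        | last => exact hle
        | cast i => exact hfy i
      -- Projecting along `y` onto the kernel of the last functional removes it from the system.
      obtain ⟨w, hw, hg⟩ := ih (fun i => f i.castSucc - (f i.castSucc y / l y) • l)
        (g - (g y / l y) • l) fun v hv => by
          have key : g (v - (l v / l y) • y) ≤ 0 := by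
            refine h _ fun i => ?_
            induction i using Fin.lastCases with
            | last => simp [← hl, hly.ne']
            | cast i =>
              have := hv i
              simp only [LinearMap.sub_apply, LinearMap.smul_apply, smul_eq_mul, map_sub,
                map_smul] at this ⊢
              calc _ = f i.castSucc v - f i.castSucc y / l y * l v := by ring
                _ ≤ 0 := this
          simp only [LinearMap.sub_apply, LinearMap.smul_apply, smul_eq_mul, map_sub,
            map_smul] at key ⊢
          calc _ = g v - l v / l y * g y := by ring
            _ ≤ 0 := key
      refine ⟨Fin.snoc w ((g y - ∑ i, w i * f i.castSucc y) / l y), fun i => ?_, ?_⟩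
      · induction i using Fin.lastCases with
        | last =>
          simp only [Fin.snoc_last]
          refine div_nonneg (sub_nonneg.2 (le_trans ?_ hgy.le)) hly.le
          exact Finset.sum_nonpos fun i _ => mul_nonpos_of_nonneg_of_nonpos (hw i) (hfy i)
        | cast i => simpa using hw i
      · ext v
        have hv := congrArg (fun F => F v) hg
        simp only [LinearMap.sub_apply, LinearMap.smul_apply, smul_eq_mul, LinearMap.sum_apply,
          mul_sub, Finset.sum_sub_distrib] at hv
        simp only [Fin.sum_univ_castSucc, LinearMap.add_apply, LinearMap.sum_apply,
          LinearMap.smul_apply, smul_eq_mul, Fin.snoc_castSucc, Fin.snoc_last, ← hl]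
        have : ∑ i, w i * (f i.castSucc y / l y * l v)
            = (∑ i, w i * f i.castSucc y) / l y * l v := by
          rw [Finset.sum_div, Finset.sum_mul]
          exact Finset.sum_congr rfl fun i _ => by ring
        rw [this] at hv
        have e : (g y - ∑ i, w i * f i.castSucc y) / l y * l v
          = g y / l y * l v - (∑ i, w i * f i.castSucc y) / l y * l v := by ring
        rw [e]
        linarith

theorem farkas_fintype {V ι : Type*} [AddCommGroup V] [Module ℝ V] [Fintype ι]
    (f : ι → Module.Dual ℝ V) (g : Module.Dual ℝ V) (h : ∀ v, (∀ i, f i v ≤ 0) → g v ≤ 0) :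
    ∃ w : ι → ℝ, (∀ i, 0 ≤ w i) ∧ g = ∑ i, w i • f i := by
  let e := Fintype.equivFin ι
  obtain ⟨w, hw, hg⟩ := farkas (fun i => f (e.symm i)) g fun v hv =>
    h v fun i => by simpa using hv (e i)
  refine ⟨fun i => w (e i), fun i => hw _, ?_⟩
  rw [hg, ← e.symm.sum_comp]
  simp

/-- The weights on a finite set under which the functionals `φ c` have mean `b`. -/
def momentWeights {V C : Type*} [AddCommGroup V] [Module ℝ V] [Fintype C]
    (φ : C → Module.Dual ℝ V) (b : Module.Dual ℝ V) : Set (C → ℝ) :=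
  {w | w ∈ stdSimplex ℝ C ∧ ∑ c, w c • φ c = b}

section Moment

variable {V C : Type*} [AddCommGroup V] [Module ℝ V] [Fintype C]
  (φ : C → Module.Dual ℝ V) (b : Module.Dual ℝ V)

/-- If no affine form `l + v` is nonnegative on all of the `φ c` but negative at `b`, then `b` is a
weighted mean of the `φ c`. -/
theorem momentWeights_nonempty
    (h : ∀ (l : ℝ) (v : V), (∀ c, 0 ≤ l + φ c v) → 0 ≤ l + b v) :
    (momentWeights φ b).Nonempty := by
  obtain ⟨w, hw, hg⟩ := farkas_fintype
    (fun c => -(LinearMap.fst ℝ ℝ V + φ c ∘ₗ LinearMap.snd ℝ ℝ V))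
    (-(LinearMap.fst ℝ ℝ V + b ∘ₗ LinearMap.snd ℝ ℝ V)) fun v hv => by
      have := h v.1 v.2 fun c => by
        have := hv c
        simp only [LinearMap.neg_apply, LinearMap.add_apply, LinearMap.fst_apply,
          LinearMap.comp_apply, LinearMap.snd_apply] at this
        linarith
      simp only [LinearMap.neg_apply, LinearMap.add_apply, LinearMap.fst_apply,
          LinearMap.comp_apply, LinearMap.snd_apply]
      linarith
  refine ⟨w, ⟨hw, ?_⟩, ?_⟩
  · have := congrArg (fun F => F (1, 0)) hg
    simp at this
    linarith
  · ext v
    have := congrArg (fun F => F (0, v)) hg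
    simp at this
    simp [this]

theorem isCompact_momentWeights : IsCompact (momentWeights φ b) := by
  have : momentWeights φ b
      = stdSimplex ℝ C ∩ ⋂ v : V, {w : C → ℝ | ∑ c, w c * φ c v = b v} := by
    ext w
    simp [momentWeights, LinearMap.ext_iff]
  rw [this]
  refine (isCompact_stdSimplex ℝ C).inter_right (isClosed_iInter fun v => ?_)
  exact isClosed_eq (by fun_prop) continuous_const

variable {φ b} in
/-- Weak duality for moment problems. -/
theorem le_of_mem_momentWeights {w : C → ℝ} (hw : w ∈ momentWeights φ b) {g : C → ℝ} {l : ℝ}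
    {v : V} (h : ∀ c, g c ≤ l + φ c v) : ∑ c, w c * g c ≤ l + b v := by
  calc ∑ c, w c * g c ≤ ∑ c, w c * (l + φ c v) :=
        Finset.sum_le_sum fun c _ => mul_le_mul_of_nonneg_left (h c) (hw.1.1 c)
    _ = l + b v := by
        rw [← hw.2]
        simp [mul_add, Finset.sum_add_distrib, ← Finset.sum_mul, hw.1.2]

/-- Strong duality, with both optima attained, for maximizing the mean of `g` over the weights
with prescribed moments. -/
theorem moment_duality (hne : (momentWeights φ b).Nonempty) (g : C → ℝ) :
    ∃ U, IsGreatest {r | ∃ w ∈ momentWeights φ b, ∑ c, w c * g c = r} U ∧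
      ∃ (l : ℝ) (v : V), (∀ c, g c ≤ l + φ c v) ∧ l + b v ≤ U := by
  obtain ⟨w₀, hw₀, hmax⟩ := (isCompact_momentWeights φ b).exists_isMaxOn hne
    (f := fun w => ∑ c, w c * g c) (by fun_prop)
  refine ⟨∑ c, w₀ c * g c, ⟨⟨w₀, hw₀, rfl⟩, ?_⟩, ?_⟩
  · rintro _ ⟨w, hw, rfl⟩
    exact hmax hw
  set U := ∑ c, w₀ c * g c with hU
  -- Farkas' lemma for the homogenized system `μ g ≤ l + φ v`, `l + b v ≤ μ U` in `(μ, l, v)`.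
  let μ := LinearMap.fst ℝ ℝ (ℝ × V)
  let L := LinearMap.fst ℝ ℝ V ∘ₗ LinearMap.snd ℝ ℝ (ℝ × V)
  let S := LinearMap.snd ℝ ℝ V ∘ₗ LinearMap.snd ℝ ℝ (ℝ × V)
  by_cases hinf : ∀ u, (∀ o : Option C, (o.elim (L + b ∘ₗ S - U • μ)
      fun c => g c • μ - L - φ c ∘ₗ S) u ≤ 0) → μ u ≤ 0
  · exfalso
    obtain ⟨w, hw, hμ⟩ := farkas_fintype _ _ hinf
    have h1 := congrArg (fun F => F (1, 0, 0)) hμ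
    have h2 := congrArg (fun F => F (0, 1, 0)) hμ
    have h3 : ∀ v, w none * b v = ∑ c, w (some c) * φ c v := fun v => by
      have := congrArg (fun F => F (0, 0, v)) hμ
      simp [μ, L, S, Fintype.sum_option] at this
      linarith
    simp [μ, L, S, Fintype.sum_option] at h1 h2
    have h2' : ∑ c, w (some c) = w none := by linarith
    have hpos : 0 < w none := by
      refine lt_of_le_of_ne (hw none) fun h0 => ?_
      have hz : ∀ c, w (some c) = 0 := fun c =>
        (Finset.sum_eq_zero_iff_of_nonneg fun c _ => hw (some c)).1 (h2'.trans h0.symm) c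
          (Finset.mem_univ c)
      simp [hz, ← h0] at h1
    have hmem : (fun c => w (some c) / w none) ∈ momentWeights φ b := by
      refine ⟨⟨fun c => div_nonneg (hw _) hpos.le, ?_⟩, ?_⟩
      · rw [← Finset.sum_div, h2', div_self hpos.ne']
      · ext v
        simp only [LinearMap.sum_apply, LinearMap.smul_apply, smul_eq_mul, div_mul_eq_mul_div]
        rw [← Finset.sum_div, ← h3, mul_div_cancel_left₀ _ hpos.ne']
    have := hmax hmem
    simp only [Set.mem_ofPred_eq, div_mul_eq_mul_div, ← Finset.sum_div] at this
    rw [div_le_iff₀ hpos] at this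
    nlinarith
  · push Not at hinf
    obtain ⟨⟨m, l, v⟩, hu, hm⟩ := hinf
    replace hm : 0 < m := hm
    refine ⟨m⁻¹ * l, m⁻¹ • v, fun c => ?_, ?_⟩
    · have := hu (some c)
      simp [μ, L, S] at this
      rw [map_smul, smul_eq_mul, ← mul_add, le_inv_mul_iff₀ hm]
      linarith
    · have := hu none
      simp [μ, L, S] at this
      rw [map_smul, smul_eq_mul, ← mul_add, inv_mul_le_iff₀ hm]
      linarith

end Moment

/-! ### Parents and subtrees of a rooted tree -/

namespace OrderedTree

variable {n : ℕ} (T : OrderedTree n)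

variable {T} in
/-- A node has at most one parent: it is the penultimate node of the path from the root. -/
theorem Arc.unique {i i' j : Fin n} (h : T.Arc i j) (h' : T.Arc i' j) : i = i' := by
  obtain ⟨P, hP, hlen⟩ := T.isTree.connected.exists_path_of_dist T.root j
  have key : ∀ {a}, T.Arc a j → a = P.penultimate := fun {a} ha =>
    T.isTree.isAcyclic.eq_penultimate_of_adj_end hP ha.1.symm (by
      classical
      obtain ⟨Q, hQ, hQl⟩ := T.isTree.connected.exists_path_of_dist T.root a
      have hjQ : j ∉ Q.support := fun hj => by
        have := SimpleGraph.dist_le (Q.takeUntil j hj)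
        have := Q.length_takeUntil_le_length hj
        have := ha.2
        omega
      exact T.isTree.isAcyclic.mem_support_of_ne_mem_support_of_adj_of_isPath hP hQ ha.1.symm hjQ)
  rw [key h, key h']

theorem not_arc_root (i : Fin n) : ¬ T.Arc i T.root := fun h => by
  have := h.2
  simp at this

theorem exists_arc {j : Fin n} (hj : j ≠ T.root) : ∃ i, T.Arc i j := by
  obtain ⟨P, hP, hlen⟩ := T.isTree.connected.exists_path_of_dist T.root j
  have hnil : ¬ P.Nil := fun h => hj h.eq.symm
  have hadj := P.adj_penultimate hnil
  refine ⟨P.penultimate, hadj, ?_⟩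
  have h1 := SimpleGraph.dist_le P.dropLast
  have h2 : P.dropLast.length + 1 = P.length := P.length_dropLast_add_one hnil
  have h3 := hadj.diff_dist_adj (u := T.root)
  omega

open Classical in
/-- The parent of a node; by convention the root is its own parent. -/
noncomputable def parent (j : Fin n) : Fin n := if h : ∃ i, T.Arc i j then h.choose else j

theorem arc_parent {j : Fin n} (hj : j ≠ T.root) : T.Arc (T.parent j) j := by
  rw [parent, dif_pos (T.exists_arc hj)]
  exact (T.exists_arc hj).choose_spec

theorem arc_iff {i j : Fin n} : T.Arc i j ↔ j ≠ T.root ∧ i = T.parent j :=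
  ⟨fun h => have hj : j ≠ T.root := fun e => T.not_arc_root i (e ▸ h)
    ⟨hj, h.unique (T.arc_parent hj)⟩, fun h => h.2 ▸ T.arc_parent h.1⟩

theorem wellFounded_arc : WellFounded T.Arc :=
  Subrelation.wf (fun {i j} h => by
      have := h.2
      show T.graph.dist T.root i < T.graph.dist T.root j
      omega)
    (InvImage.wf (fun i => T.graph.dist T.root i) Nat.lt_wfRel.wf)

theorem wellFounded_arc_swap : WellFounded fun j i => T.Arc i j :=
  Subrelation.wf (fun {j i} h => by
      have := h.2
      have := Finset.single_le_sum (f := fun v => T.graph.dist T.root v) (fun _ _ => Nat.zero_le _)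
        (Finset.mem_univ j)
      show ∑ v, T.graph.dist T.root v - T.graph.dist T.root j
        < ∑ v, T.graph.dist T.root v - T.graph.dist T.root i
      omega)
    (InvImage.wf (fun i => ∑ v, T.graph.dist T.root v - T.graph.dist T.root i) Nat.lt_wfRel.wf)

open Classical in
theorem sum_arcs {M : Type*} [AddCommMonoid M] (f : Fin n → Fin n → M) :
    ∑ e ∈ T.arcs, f e.1 e.2 = ∑ i, ∑ j with T.Arc i j, f i j := by
  simp_rw [arcs, Finset.sum_filter, Fintype.sum_prod_type]

open Classical in
theorem sum_parents {M : Type*} [AddCommMonoid M] (f : Fin n → M) (j : Fin n) :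
    ∑ i with T.Arc i j, f i = if j = T.root then 0 else f (T.parent j) := by
  simp_rw [Finset.sum_filter, T.arc_iff]
  split_ifs with h <;> simp [h]

open Classical in
theorem sum_arcs_eq_sum_parent {M : Type*} [AddCommMonoid M] (f : Fin n → Fin n → M) :
    ∑ e ∈ T.arcs, f e.1 e.2 = ∑ j ∈ Finset.univ.erase T.root, f (T.parent j) j := by
  have : ∑ e ∈ T.arcs, f e.1 e.2 = ∑ j, ∑ i with T.Arc i j, f i j := by
    simp_rw [arcs, Finset.sum_filter, Fintype.sum_prod_type]
    exact Finset.sum_comm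
  rw [this]
  simp_rw [T.sum_parents]
  rw [← Finset.sum_erase (a := T.root) Finset.univ (by simp)]
  exact Finset.sum_congr rfl fun j hj => if_neg (Finset.ne_of_mem_erase hj)

theorem mem_children {i j : Fin n} : j ∈ T.children i ↔ T.Arc i j := by
  simp only [children, List.mem_filter, List.mem_ofFn, decide_eq_true_eq, and_iff_right_iff_imp]
  exact fun _ => T.order.surjective j

theorem nodup_children (i : Fin n) : (T.children i).Nodup :=
  (List.nodup_ofFn.2 T.order.injective).filter _

theorem child_eq {i : Fin n} {s : ℕ} (hs : 1 ≤ s) (hsd : s ≤ T.deg i) :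
    T.child i s = (T.children i)[s - 1]'(by rw [deg] at hsd; omega) := by
  rw [child, List.getD_eq_getElem]

theorem arc_child {i : Fin n} {s : ℕ} (hs : 1 ≤ s) (hsd : s ≤ T.deg i) :
    T.Arc i (T.child i s) := by
  rw [← mem_children, T.child_eq hs hsd]
  exact List.getElem_mem _

theorem parent_child {i : Fin n} {s : ℕ} (hs : 1 ≤ s) (hsd : s ≤ T.deg i) :
    T.parent (T.child i s) = i :=
  (T.arc_iff.1 (T.arc_child hs hsd)).2.symm

theorem mem_nodes {i v : Fin n} {s : ℕ} : v ∈ T.nodes i s ↔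
    v = i ∨ ∃ c ∈ (T.children i).take s, Relation.ReflTransGen T.Arc c v := by
  simp [nodes]

theorem mem_nodes_deg {i v : Fin n} :
    v ∈ T.nodes i (T.deg i) ↔ Relation.ReflTransGen T.Arc i v := by
  rw [mem_nodes, deg, List.take_length]
  constructor
  · rintro (rfl | ⟨c, hc, h⟩)
    · exact .refl
    · exact .head (T.mem_children.1 hc) h
  · intro h
    rcases h.cases_head with h | ⟨c, hc, h⟩
    · exact .inl h.symm
    · exact .inr ⟨c, T.mem_children.2 hc, h⟩

theorem self_mem_nodes (i : Fin n) (s : ℕ) : i ∈ T.nodes i s := T.mem_nodes.2 (.inl rfl)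

theorem nodes_zero (i : Fin n) : T.nodes i 0 = {i} := by
  ext v; simp [mem_nodes]

theorem dist_le_of_reflTransGen {i v : Fin n} (h : Relation.ReflTransGen T.Arc i v) :
    T.graph.dist T.root i ≤ T.graph.dist T.root v := by
  induction h with
  | refl => rfl
  | tail _ h ih => have := h.2; omega

/-- Siblings have no common descendant. -/
theorem eq_of_common_descendant {i c c' v : Fin n} (hc : T.Arc i c) (hc' : T.Arc i c')
    (h : Relation.ReflTransGen T.Arc c v) (h' : Relation.ReflTransGen T.Arc c' v) : c = c' := by
  induction h with
  | refl =>
    rcases h'.cases_tail with h | ⟨b, hb, hbc⟩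
    · exact h
    · have := T.dist_le_of_reflTransGen hb
      have := hbc.2; have := hc.2; have := hc'.2
      omega
  | @tail u w hcu hu ih =>
    rcases h'.cases_tail with h | ⟨b, hb, hbc⟩
    · subst h
      have := T.dist_le_of_reflTransGen hcu
      have := hu.2; have := hc.2; have := hc'.2
      omega
    · exact ih (hu.unique hbc ▸ hb)

theorem nodes_step {i : Fin n} {s : ℕ} (hs : 1 ≤ s) (hsd : s ≤ T.deg i) :
    T.nodes i s = T.nodes i (s - 1) ∪ T.nodes (T.child i s) (T.deg (T.child i s)) := by
  obtain ⟨s, rfl⟩ : ∃ m, s = m + 1 := ⟨s - 1, by omega⟩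
  ext v
  rw [Finset.mem_union, mem_nodes_deg, mem_nodes, mem_nodes, T.child_eq hs hsd,
    List.take_succ_eq_append_getElem (by rw [deg] at hsd; omega)]
  simp only [List.mem_append, List.mem_singleton, Nat.add_sub_cancel]
  constructor
  · rintro (h | ⟨c, h | rfl, hc⟩)
    exacts [.inl (.inl h), .inl (.inr ⟨c, h, hc⟩), .inr hc]
  · rintro ((h | ⟨c, h, hc⟩) | h)
    exacts [.inl h, .inr ⟨c, .inl h, hc⟩, .inr ⟨_, .inr rfl, h⟩]

theorem disjoint_nodes {i : Fin n} {s : ℕ} (hs : 1 ≤ s) (hsd : s ≤ T.deg i) :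
    Disjoint (T.nodes i (s - 1)) (T.nodes (T.child i s) (T.deg (T.child i s))) := by
  obtain ⟨s, rfl⟩ : ∃ m, s = m + 1 := ⟨s - 1, by omega⟩
  have hc := T.arc_child hs hsd
  rw [Finset.disjoint_left]
  intro v hv hv'
  rw [mem_nodes_deg] at hv'
  rcases T.mem_nodes.1 hv with rfl | ⟨c, hcm, hcv⟩
  · have := T.dist_le_of_reflTransGen hv'
    have := hc.2
    omega
  · have hcc := T.eq_of_common_descendant (T.mem_children.1 (List.mem_of_mem_take hcm)) hc hcv hv'
    rw [T.child_eq hs hsd] at hcc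
    simp only [Nat.add_sub_cancel] at hcc hcm
    obtain ⟨m, hm, hmc⟩ := List.mem_take_iff_getElem.1 hcm
    have := (T.nodup_children i).getElem_inj_iff.1 (hmc.trans hcc)
    omega

theorem size_step {i : Fin n} {s : ℕ} (hs : 1 ≤ s) (hsd : s ≤ T.deg i) :
    T.size i s = T.size i (s - 1) + T.size (T.child i s) (T.deg (T.child i s)) := by
  rw [size, T.nodes_step hs hsd, Finset.card_union_of_disjoint (T.disjoint_nodes hs hsd)]
  rfl

theorem size_zero (i : Fin n) : T.size i 0 = 1 := by simp [size, nodes_zero]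

theorem size_pos (i : Fin n) (s : ℕ) : 1 ≤ T.size i s :=
  Finset.card_pos.2 ⟨i, T.self_mem_nodes i s⟩

theorem parent_mem_nodes {i v : Fin n} {s : ℕ} (hv : v ∈ T.nodes i s) (hvi : v ≠ i) :
    T.parent v ∈ T.nodes i s := by
  rcases T.mem_nodes.1 hv with h | ⟨c, hc, h⟩
  · exact absurd h hvi
  · rcases h.cases_tail with rfl | ⟨b, hb, hbv⟩
    · rw [← (T.arc_iff.1 (T.mem_children.1 (List.mem_of_mem_take hc))).2]
      exact T.self_mem_nodes i s
    · rw [← (T.arc_iff.1 hbv).2]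
      exact T.mem_nodes.2 (.inr ⟨c, hc, hb⟩)

theorem nodes_root : T.nodes T.root (T.deg T.root) = Finset.univ := by
  refine Finset.eq_univ_iff_forall.2 fun v => T.mem_nodes_deg.2 ?_
  induction v using T.wellFounded_arc.induction with
  | _ v ih =>
    by_cases hv : v = T.root
    · exact hv ▸ .refl
    · exact .tail (ih _ (T.arc_parent hv)) (T.arc_parent hv)

end OrderedTree

/-! ### The pairwise energy and its tree decomposition -/

section

variable {n : ℕ} (T : OrderedTree n)

/-- The `0`-`1` vector of a configuration, with real entries. -/
def indicator (c : Fin n → Fin 2) (i : Fin n) : ℝ := ((c i : ℕ) : ℝ)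

/-- The linear form `(α, β) ↦ ∑ i, α i * p i + ∑ (i, j) ∈ E, β i j * q i j`. -/
noncomputable def energy (p : Fin n → ℝ) (q : Fin n → Fin n → ℝ) :
    Module.Dual ℝ ((Fin n → ℝ) × (Fin n → Fin n → ℝ)) where
  toFun v := ∑ i, v.1 i * p i + ∑ e ∈ T.arcs, v.2 e.1 e.2 * q e.1 e.2
  map_add' v w := by
    simp only [Prod.fst_add, Prod.snd_add, Pi.add_apply, add_mul, Finset.sum_add_distrib]
    ring
  map_smul' r v := by
    simp only [Prod.smul_fst, Prod.smul_snd, Pi.smul_apply, smul_eq_mul, mul_assoc,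
      ← Finset.mul_sum, RingHom.id_apply, mul_add]

theorem energy_apply (p : Fin n → ℝ) (q : Fin n → Fin n → ℝ)
    (v : (Fin n → ℝ) × (Fin n → Fin n → ℝ)) :
    energy T p q v = ∑ i, v.1 i * p i + ∑ e ∈ T.arcs, v.2 e.1 e.2 * q e.1 e.2 := rfl

/-- The energy of a `0`-`1` configuration on the nodes. -/
noncomputable def configEnergy (c : Fin n → Fin 2) :
    Module.Dual ℝ ((Fin n → ℝ) × (Fin n → Fin n → ℝ)) :=
  energy T (indicator c) fun i j => indicator c i * indicator c j

/-- The local (Boole-Fréchet) inequalities on univariate and bivariate probabilities. -/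
structure LocallyConsistent (p : Fin n → ℝ) (q : Fin n → Fin n → ℝ) : Prop where
  nonneg : ∀ i, 0 ≤ p i
  le_one : ∀ i, p i ≤ 1
  pair_nonneg : ∀ i j, T.Arc i j → 0 ≤ q i j
  pair_le_left : ∀ i j, T.Arc i j → q i j ≤ p i
  pair_le_right : ∀ i j, T.Arc i j → q i j ≤ p j
  le_pair : ∀ i j, T.Arc i j → p i + p j - 1 ≤ q i j

theorem indicator_eq_zero_or_one (c : Fin n → Fin 2) (i : Fin n) :
    indicator c i = 0 ∨ indicator c i = 1 := by
  unfold indicator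
  generalize c i = a
  fin_cases a <;> simp

theorem locallyConsistent_indicator (c : Fin n → Fin 2) :
    LocallyConsistent T (indicator c) fun i j => indicator c i * indicator c j := by
  constructor <;> intro i <;> rcases indicator_eq_zero_or_one c i with hi | hi <;>
    simp [hi] <;> intro j _ <;> rcases indicator_eq_zero_or_one c j with hj | hj <;> simp [hj]

open Classical in
/-- The rows of the linear program that only involve the multipliers `τ, Δ, η, γ, χ`: they certify
that `l + ∑ α i c i + ∑ β i j c i c j` is nonnegative for all configurations `c`. -/
structure IsCertificate (l : ℝ) (α : Fin n → ℝ) (β : Fin n → Fin n → ℝ) (τ : Fin n → ℝ)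
    (Δ η γ χ : Fin n → Fin n → ℝ) : Prop where
  nonneg : ∀ i j, T.Arc i j → 0 ≤ η i j ∧ 0 ≤ γ i j ∧ 0 ≤ Δ i j ∧ 0 ≤ χ i j
  nonneg_τ : ∀ i, 0 ≤ τ i
  const_row : l - ∑ e ∈ T.arcs, (Δ e.1 e.2 + χ e.1 e.2) - ∑ i, τ i ≥ 0
  node_row : ∀ i,
    ∑ j with T.Arc i j, (Δ i j - η i j) + ∑ j with T.Arc j i, (Δ j i - γ j i) + τ i + α i ≥ 0
  arc_row : ∀ i j, T.Arc i j → η i j + γ i j - Δ i j + χ i j + β i j ≥ 0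

theorem OrderedTree.mem_arcs {e : Fin n × Fin n} : e ∈ T.arcs ↔ T.Arc e.1 e.2 := by
  simp [OrderedTree.arcs]

variable {T}

/-- Weak duality for the local relaxation. -/
theorem IsCertificate.nonneg_energy {l : ℝ} {α : Fin n → ℝ} {β : Fin n → Fin n → ℝ}
    {τ : Fin n → ℝ} {Δ η γ χ : Fin n → Fin n → ℝ} (h : IsCertificate T l α β τ Δ η γ χ)
    {p : Fin n → ℝ} {q : Fin n → Fin n → ℝ} (hpq : LocallyConsistent T p q) :
    0 ≤ l + energy T p q (α, β) := by
  classical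
  have hnode : 0 ≤ ∑ e ∈ T.arcs, p e.1 * (Δ e.1 e.2 - η e.1 e.2)
      + ∑ e ∈ T.arcs, p e.2 * (Δ e.1 e.2 - γ e.1 e.2) + ∑ i, p i * τ i + ∑ i, α i * p i := by
    have h1 : 0 ≤ ∑ i, p i * (∑ j with T.Arc i j, (Δ i j - η i j)
        + ∑ j with T.Arc j i, (Δ j i - γ j i) + τ i + α i) :=
      Finset.sum_nonneg fun i _ => mul_nonneg (hpq.nonneg i) (h.node_row i)
    simp only [mul_add, Finset.sum_add_distrib, Finset.mul_sum] at h1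
    convert h1 using 2
    · congr 1
      congr 1
      · rw [T.sum_arcs fun i j => p i * (Δ i j - η i j)]
      · rw [T.sum_arcs_eq_sum_parent fun i j => p j * (Δ i j - γ i j)]
        simp_rw [T.sum_parents]
        rw [← Finset.sum_erase (a := T.root) Finset.univ (by simp)]
        exact Finset.sum_congr rfl fun j hj => (if_neg (Finset.ne_of_mem_erase hj)).symm
    · exact Finset.sum_congr rfl fun i _ => mul_comm _ _
  have hτ : ∑ i, p i * τ i ≤ ∑ i, τ i := Finset.sum_le_sum fun i _ =>
    mul_le_of_le_one_left (h.nonneg_τ i) (hpq.le_one i)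
  have harc : ∑ e ∈ T.arcs, p e.1 * (Δ e.1 e.2 - η e.1 e.2)
      + ∑ e ∈ T.arcs, p e.2 * (Δ e.1 e.2 - γ e.1 e.2)
      - ∑ e ∈ T.arcs, (Δ e.1 e.2 + χ e.1 e.2) ≤ ∑ e ∈ T.arcs, β e.1 e.2 * q e.1 e.2 := by
    rw [← Finset.sum_add_distrib, ← Finset.sum_sub_distrib]
    refine Finset.sum_le_sum fun e he => ?_
    have he := T.mem_arcs.1 he
    obtain ⟨h1, h2, h3, h4⟩ := h.nonneg _ _ he
    have h5 := mul_nonneg (hpq.pair_nonneg _ _ he) (h.arc_row _ _ he)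
    have h6 := mul_nonneg h1 (sub_nonneg.2 (hpq.pair_le_left _ _ he))
    have h7 := mul_nonneg h2 (sub_nonneg.2 (hpq.pair_le_right _ _ he))
    have h8 := mul_nonneg h3 (sub_nonneg.2 (hpq.le_pair _ _ he))
    have h9 := mul_nonneg h4
      (sub_nonneg.2 ((hpq.pair_le_left _ _ he).trans (hpq.le_one e.1)))
    linarith
  have := h.const_row
  rw [energy_apply]
  simp only
  linarith

open Classical in
variable (T) in
/-- Existence of the min-sum potentials: `F i a` is the least energy of the subtree below `i` when
`i` has value `a`. -/
theorem exists_potential (α : Fin n → ℝ) (β : Fin n → Fin n → ℝ) :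
    ∃ F : Fin n → Fin 2 → ℝ, ∀ i a, F i a = α i * (a : ℕ)
      + ∑ j with T.Arc i j, min (F j 0) (F j 1 + β i j * (a : ℕ)) := by
  let step : ∀ i, (∀ j, T.Arc i j → Fin 2 → ℝ) → Fin 2 → ℝ := fun i G a => α i * (a : ℕ)
    + ∑ j, if h : T.Arc i j then min (G j h 0) (G j h 1 + β i j * (a : ℕ)) else 0
  refine ⟨T.wellFounded_arc_swap.fix step, fun i a => ?_⟩
  conv_lhs => rw [T.wellFounded_arc_swap.fix_eq]
  simp only [step, Finset.sum_filter, dite_eq_ite]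

open Classical in
/-- Minimizing from the root downwards attains the potential of the root. -/
theorem exists_config_of_potential {α : Fin n → ℝ} {β : Fin n → Fin n → ℝ}
    {F : Fin n → Fin 2 → ℝ} (hF : ∀ i a, F i a = α i * (a : ℕ)
      + ∑ j with T.Arc i j, min (F j 0) (F j 1 + β i j * (a : ℕ))) (y : Fin 2) :
    ∃ c, configEnergy T c (α, β) = F T.root y := by
  let step : ∀ j, (∀ i, T.Arc i j → Fin 2) → Fin 2 := fun j G =>
    if h : j = T.root then y else
      if F j 0 ≤ F j 1 + β (T.parent j) j * (G _ (T.arc_parent h) : ℕ) then 0 else 1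
  let c := T.wellFounded_arc.fix step
  have hroot : c T.root = y := by
    simp only [c]
    rw [T.wellFounded_arc.fix_eq]
    simp [step]
  have hmin : ∀ i j, T.Arc i j → min (F j 0) (F j 1 + β i j * (c i : ℕ))
      = F j (c j) + β i j * (indicator c i * indicator c j) := by
    intro i j hij
    obtain ⟨hj, rfl⟩ := T.arc_iff.1 hij
    have hcj : c j = if F j 0 ≤ F j 1 + β (T.parent j) j * (c (T.parent j) : ℕ) then 0 else 1 := by
      simp only [c]
      conv_lhs => rw [T.wellFounded_arc.fix_eq]
      simp [step, hj]
    unfold indicator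
    rw [hcj]
    split_ifs with h
    · simpa using h
    · simpa using (not_le.1 h).le
  refine ⟨c, ?_⟩
  have h1 : ∑ i, F i (c i) = ∑ i, α i * indicator c i + (∑ j ∈ Finset.univ.erase T.root, F j (c j)
      + ∑ e ∈ T.arcs, β e.1 e.2 * (indicator c e.1 * indicator c e.2)) := by
    rw [← T.sum_arcs_eq_sum_parent fun _ j => F j (c j), ← Finset.sum_add_distrib,
      T.sum_arcs fun i j => F j (c j) + β i j * (indicator c i * indicator c j),
      ← Finset.sum_add_distrib]
    refine Finset.sum_congr rfl fun i _ => ?_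
    rw [hF, indicator]
    congr 1
    exact Finset.sum_congr rfl fun j hj => hmin i j (Finset.mem_filter.1 hj).2
  rw [← Finset.add_sum_erase _ _ (Finset.mem_univ T.root), hroot] at h1
  rw [configEnergy, energy_apply]
  simp only
  linarith

/-- On a tree, nonnegativity over all configurations is certified by the local multipliers: with
min-sum messages `m i j a = min (F j 0) (F j 1 + β i j * a)`, the energy is the sum of the
nonnegative functions `F j b + β i j * a * b - m i j a` on the arcs and of the potential at the
root, and the multipliers are the values of these functions. -/
theorem exists_certificate {l : ℝ} {α : Fin n → ℝ} {β : Fin n → Fin n → ℝ}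
    (h : ∀ c, 0 ≤ l + configEnergy T c (α, β)) :
    ∃ τ Δ η γ χ, IsCertificate T l α β τ Δ η γ χ := by
  classical
  obtain ⟨F, hF⟩ := exists_potential T α β
  have hroot : ∀ y, 0 ≤ l + F T.root y := fun y => by
    obtain ⟨c, hc⟩ := exists_config_of_potential hF y
    exact hc ▸ h c
  let m : Fin n → Fin n → Fin 2 → ℝ := fun i j a => min (F j 0) (F j 1 + β i j * (a : ℕ))
  have hF0 : ∀ i, F i 0 = ∑ j with T.Arc i j, m i j 0 := fun i => by
    rw [hF i 0]; simp [m]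
  have hF1 : ∀ i, F i 1 = α i + ∑ j with T.Arc i j, m i j 1 := fun i => by
    rw [hF i 1]; simp [m]
  have hm : ∀ i j a, m i j a ≤ F j 0 ∧ m i j a ≤ F j 1 + β i j * (a : ℕ) := fun i j a =>
    ⟨min_le_left _ _, min_le_right _ _⟩
  refine ⟨fun i => if i = T.root then l + F i 0 else 0, fun i j => F j 0 - m i j 0,
    fun i j => F j 0 - m i j 1, fun i j => F j 1 - m i j 0, fun _ _ => 0, ⟨?_, ?_, ?_, ?_, ?_⟩⟩
  · intro i j _
    have h0 := hm i j 0
    have h1 := hm i j 1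
    simp only [Fin.val_zero, Nat.cast_zero, mul_zero, add_zero] at h0
    exact ⟨by linarith, by linarith, by linarith, le_rfl⟩
  · intro i
    split_ifs with hi
    · exact hi ▸ hroot 0
    · exact le_rfl
  · have h1 : ∑ e ∈ T.arcs, F e.2 0 = ∑ j ∈ Finset.univ.erase T.root, F j 0 :=
      T.sum_arcs_eq_sum_parent fun _ j => F j 0
    have h2 : ∑ e ∈ T.arcs, m e.1 e.2 0 = ∑ i, F i 0 := by
      rw [T.sum_arcs fun i j => m i j 0]
      exact Finset.sum_congr rfl fun i _ => (hF0 i).symm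
    rw [← Finset.add_sum_erase _ _ (Finset.mem_univ T.root)] at h2
    simp only [add_zero, Finset.sum_sub_distrib, h1, h2, Finset.sum_ite_eq', Finset.mem_univ,
      if_true]
    linarith
  · intro i
    have h1 : ∑ j with T.Arc i j, (F j 0 - m i j 0 - (F j 0 - m i j 1)) = F i 1 - α i - F i 0 := by
      rw [hF1, hF0, add_sub_cancel_left, ← Finset.sum_sub_distrib]
      exact Finset.sum_congr rfl fun j _ => by ring
    have h2 : ∀ j, F i 0 - m j i 0 - (F i 1 - m j i 0) = F i 0 - F i 1 := fun j => by ring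
    simp only [h1, h2, T.sum_parents fun _ => F i 0 - F i 1]
    split_ifs with hi
    · have := hroot 1
      rw [← hi] at this
      linarith
    · linarith
  · intro i j _
    have hb := hm i j 1
    simp only [Fin.val_one, Nat.cast_one, mul_one] at hb
    linarith [hb.2]

end

/-! ### The dynamic program over partial subtrees -/

section

variable {n : ℕ} (T : OrderedTree n)

/-- The number of ones of a configuration on `V(i, s)`. -/
noncomputable def count (c : Fin n → Fin 2) (i : Fin n) (s : ℕ) : ℕ := ∑ v ∈ T.nodes i s, (c v : ℕ)

/-- The energy of a configuration on the subtree with nodes `V(i, s)`; the arc that leads to a node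
`v ≠ i` is accounted for at `v`. -/
noncomputable def partialEnergy (α : Fin n → ℝ) (β : Fin n → Fin n → ℝ) (c : Fin n → Fin 2)
    (i : Fin n) (s : ℕ) : ℝ :=
  α i * indicator c i + ∑ v ∈ (T.nodes i s).erase i,
    (α v * indicator c v + β (T.parent v) v * (indicator c (T.parent v) * indicator c v))

variable {T} {α : Fin n → ℝ} {β : Fin n → Fin n → ℝ} {c c' : Fin n → Fin 2} {i : Fin n} {s : ℕ}

theorem count_congr (h : ∀ v ∈ T.nodes i s, c v = c' v) : count T c i s = count T c' i s :=
  Finset.sum_congr rfl fun v hv => by rw [h v hv]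

theorem partialEnergy_congr (h : ∀ v ∈ T.nodes i s, c v = c' v) :
    partialEnergy T α β c i s = partialEnergy T α β c' i s := by
  unfold partialEnergy indicator
  rw [h i (T.self_mem_nodes i s)]
  congr 1
  refine Finset.sum_congr rfl fun v hv => ?_
  rw [Finset.mem_erase] at hv
  rw [h v hv.2, h _ (T.parent_mem_nodes hv.2 hv.1)]

variable (T c) in
theorem count_zero (i : Fin n) : count T c i 0 = c i := by
  simp [count, T.nodes_zero]

variable (T α β c) in
theorem partialEnergy_zero (i : Fin n) : partialEnergy T α β c i 0 = α i * indicator c i := by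
  simp [partialEnergy, T.nodes_zero]

variable (c) in
theorem count_step (hs : 1 ≤ s) (hsd : s ≤ T.deg i) : count T c i s
    = count T c i (s - 1) + count T c (T.child i s) (T.deg (T.child i s)) := by
  rw [count, T.nodes_step hs hsd, Finset.sum_union (T.disjoint_nodes hs hsd)]
  rfl

variable (α β c) in
theorem partialEnergy_step (hs : 1 ≤ s) (hsd : s ≤ T.deg i) : partialEnergy T α β c i s
    = partialEnergy T α β c i (s - 1)
      + partialEnergy T α β c (T.child i s) (T.deg (T.child i s))
      + β i (T.child i s) * (indicator c i * indicator c (T.child i s)) := by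
  have hdisj := T.disjoint_nodes hs hsd
  have hi : i ∉ T.nodes (T.child i s) (T.deg (T.child i s)) :=
    Finset.disjoint_left.1 hdisj (T.self_mem_nodes i _)
  rw [partialEnergy, T.nodes_step hs hsd, Finset.erase_union_distrib, Finset.erase_eq_of_notMem hi,
    Finset.sum_union (hdisj.mono_left (Finset.erase_subset _ _)),
    ← Finset.add_sum_erase _ _ (T.self_mem_nodes (T.child i s) _), T.parent_child hs hsd,
    partialEnergy, partialEnergy]
  ring

variable (T α β c) in
theorem partialEnergy_root :
    partialEnergy T α β c T.root (T.deg T.root) = configEnergy T c (α, β) := by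
  rw [partialEnergy, T.nodes_root, configEnergy, energy_apply,
    T.sum_arcs_eq_sum_parent fun i j => β i j * (indicator c i * indicator c j),
    Finset.sum_add_distrib, ← Finset.add_sum_erase _ _ (Finset.mem_univ T.root), add_assoc]

variable (T c) in
theorem count_root : count T c T.root (T.deg T.root) = ∑ v, (c v : ℕ) := by
  rw [count, T.nodes_root]

variable (T c i s) in
theorem le_count : (c i : ℕ) ≤ count T c i s :=
  Finset.single_le_sum (f := fun v => (c v : ℕ)) (fun _ _ => Nat.zero_le _) (T.self_mem_nodes i s)

variable (T c i s) in
theorem count_add_one_le : count T c i s + 1 ≤ T.size i s + c i := by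
  have h1 : ∑ v ∈ (T.nodes i s).erase i, (c v : ℕ) ≤ ((T.nodes i s).erase i).card := by
    simpa using Finset.sum_le_card_nsmul ((T.nodes i s).erase i) (fun v => (c v : ℕ)) 1
      fun v _ => by omega
  have h2 := Finset.card_erase_add_one (T.self_mem_nodes i s)
  rw [count, ← Finset.add_sum_erase _ _ (T.self_mem_nodes i s), OrderedTree.size]
  omega

/-- In a feasible solution, `x i s y t` is at most the energy on `V(i, s)` of each configuration
with value `y` at `i` and `t` ones. -/
theorem LPVars.Feasible.x_le_partialEnergy {k : ℕ} {v : LPVars n} (hv : v.Feasible T k)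
    (c : Fin n → Fin 2) (i : Fin n) (s : ℕ) (hs : s ≤ T.deg i) :
    v.x i s (c i) (count T c i s) ≤ partialEnergy T v.α v.β c i s := by
  induction i using T.wellFounded_arc_swap.induction generalizing s with
  | _ i ih =>
  induction s with
  | zero =>
    rw [count_zero, partialEnergy_zero, indicator]
    have h0 := hv.base_zero i 0 (by simp)
    have h1 := hv.base_one i 0 (by simp)
    generalize c i = a
    fin_cases a
    · simpa using h0.le
    · simpa using (sub_eq_zero.1 h1).le
  | succ s ihs =>
    have hs1 : 1 ≤ s + 1 := by omega
    have hstep := partialEnergy_step v.α v.β c hs1 hs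
    have hcount := count_step c hs1 hs
    have hsize := T.size_step hs1 hs
    have hch := ih _ (T.arc_child hs1 hs) _ le_rfl
    have hl := le_count T c (T.child i (s + 1)) (T.deg (T.child i (s + 1)))
    have hu := count_add_one_le T c (T.child i (s + 1)) (T.deg (T.child i (s + 1)))
    have hl' := le_count T c i s
    have hu' := count_add_one_le T c i s
    have hpos := T.size_pos i s
    have hpos' := T.size_pos (T.child i (s + 1)) (T.deg (T.child i (s + 1)))
    rw [hstep, hcount]
    rw [Nat.add_sub_cancel] at hsize ⊢
    unfold indicator
    generalize count T c (T.child i (s + 1)) (T.deg (T.child i (s + 1))) = b at *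
    rcases s.eq_zero_or_pos with rfl | hs2
    · rw [count_zero, partialEnergy_zero, indicator]
      rw [T.size_zero] at hsize
      have h00 := hv.first_00 i hs b
      have h01 := hv.first_01 i hs b
      have h10 := hv.first_10 i hs (1 + b)
      have h11 := hv.first_11 i hs (1 + b)
      simp only [Finset.mem_Icc, Nat.add_sub_cancel_left] at h00 h01 h10 h11
      simp only [zero_add] at *
      generalize c i = y at *
      generalize c (T.child i 1) = y' at *
      fin_cases y <;> fin_cases y' <;> simp at hl hu hch ⊢
      · linarith [h00 (by omega)]
      · linarith [h01 (by omega)]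
      · linarith [h10 (by omega)]
      · linarith [h11 (by omega)]
    · have ihs := ihs (by omega)
      generalize count T c i s = a at *
      have hI : s + 1 ∈ Finset.Icc 2 (T.deg i) := Finset.mem_Icc.2 ⟨by omega, hs⟩
      have h00 := hv.next_00 i (by omega) (s + 1) hI (a + b)
      have h01 := hv.next_01 i (by omega) (s + 1) hI (a + b)
      have h10 := hv.next_10 i (by omega) (s + 1) hI (a + b)
      have h11 := hv.next_11 i (by omega) (s + 1) hI (a + b)
      simp only [Finset.mem_Icc, Nat.add_sub_cancel] at h00 h01 h10 h11
      replace h00 := fun h => h00 h b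
      replace h01 := fun h => h01 h b
      replace h10 := fun h => h10 h b
      replace h11 := fun h => h11 h b
      simp only [Nat.add_sub_cancel] at h00 h01 h10 h11
      generalize c i = y at *
      generalize c (T.child i (s + 1)) = y' at *
      fin_cases y <;> fin_cases y' <;> simp at hl hu hch hl' hu' ihs ⊢
      · linarith [h00 (by omega) (by omega)]
      · linarith [h01 (by omega) (by omega)]
      · linarith [h10 (by omega) (by omega)]
      · linarith [h11 (by omega) (by omega)]

theorem LPVars.Feasible.isCertificate {k : ℕ} {v : LPVars n} (hv : v.Feasible T k) :
    IsCertificate T v.lam v.α v.β v.τ v.Δ v.η v.γ v.χ :=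
  ⟨hv.nonneg, hv.nonneg_τ, hv.const_row, hv.node_row, hv.arc_row⟩

/-- A feasible solution dominates the indicator of the event of having at least `k` ones. -/
theorem LPVars.Feasible.indicator_le {k : ℕ} {v : LPVars n} (hv : v.Feasible T k)
    (c : Fin n → Fin 2) :
    (if k ≤ ∑ i, (c i : ℕ) then 1 else 0) ≤ v.lam + configEnergy T c (v.α, v.β) := by
  split_ifs with hk
  · have h1 := hv.x_le_partialEnergy c T.root _ le_rfl
    rw [partialEnergy_root, count_root] at h1
    have hn : ∑ i, (c i : ℕ) ≤ n := by
      simpa using Finset.sum_le_card_nsmul Finset.univ (fun v => (c v : ℕ)) 1 fun v _ => by omega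
    have h2 : v.z ≤ v.x T.root (T.deg T.root) (c T.root) (∑ i, (c i : ℕ)) := by
      have h0 := hv.root_zero _ (Finset.mem_Icc.2 ⟨hk, hn⟩)
      have h1 := hv.root_one _ (Finset.mem_Icc.2 ⟨hk, hn⟩)
      generalize c T.root = y
      fin_cases y
      · exact sub_nonneg.1 h0
      · exact sub_nonneg.1 h1
    linarith [hv.lam_z]
  · exact hv.isCertificate.nonneg_energy (locallyConsistent_indicator T c)

variable (T) in
/-- The configurations with value `y` at `i` and `t` ones on `V(i, s)`. -/
noncomputable def configs (i : Fin n) (s : ℕ) (y : Fin 2) (t : ℕ) : Finset (Fin n → Fin 2) :=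
  Finset.univ.filter fun c => c i = y ∧ count T c i s = t

theorem mem_configs {y : Fin 2} {t : ℕ} :
    c ∈ configs T i s y t ↔ c i = y ∧ count T c i s = t := by
  simp [configs]

open Classical in
variable (T α β) in
/-- The least energy on `V(i, s)` of the configurations with value `y` at `i` and `t` ones, and the
default value `D` if there are none. -/
noncomputable def dpValue (D : ℝ) (i : Fin n) (s : ℕ) (y : Fin 2) (t : ℕ) : ℝ :=
  if h : (configs T i s y t).Nonempty then
    (configs T i s y t).inf' h fun c => partialEnergy T α β c i s
  else D

theorem configs_nonempty {y : Fin 2} {t : ℕ} (h : y ≤ t) (h' : t + 1 ≤ T.size i s + y) :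
    (configs T i s y t).Nonempty := by
  classical
  have h2 := Finset.card_erase_add_one (T.self_mem_nodes i s)
  rw [OrderedTree.size] at h'
  obtain ⟨S, hS, hcard⟩ := Finset.exists_subset_card_eq (s := (T.nodes i s).erase i)
    (n := t - y) (by omega)
  have hiS : i ∉ S := fun hi => Finset.notMem_erase i _ (hS hi)
  refine ⟨fun v => if v = i then y else if v ∈ S then 1 else 0, mem_configs.2 ⟨by simp, ?_⟩⟩
  rw [count, ← Finset.add_sum_erase _ _ (T.self_mem_nodes i s)]
  have : ∑ v ∈ (T.nodes i s).erase i,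
      ((if v = i then y else if v ∈ S then 1 else 0 : Fin 2) : ℕ) = S.card := by
    rw [Finset.card_eq_sum_ones, ← Finset.sum_subset hS (f := fun v =>
      ((if v = i then y else if v ∈ S then 1 else 0 : Fin 2) : ℕ))]
    · refine Finset.sum_congr rfl fun v hv => ?_
      simp [hv, ne_of_mem_of_not_mem hv hiS]
    · intro v hv hvS
      simp [hvS, Finset.ne_of_mem_erase hv]
  rw [this, if_pos rfl, hcard]
  omega

theorem dpValue_le {D : ℝ} {y : Fin 2} {t : ℕ} (hc : c ∈ configs T i s y t) :
    dpValue T α β D i s y t ≤ partialEnergy T α β c i s := by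
  rw [dpValue, dif_pos ⟨c, hc⟩]
  exact Finset.inf'_le _ hc

theorem exists_dpValue_eq (D : ℝ) {y : Fin 2} {t : ℕ} (h : y ≤ t) (h' : t + 1 ≤ T.size i s + y) :
    ∃ c ∈ configs T i s y t, dpValue T α β D i s y t = partialEnergy T α β c i s := by
  rw [dpValue, dif_pos (configs_nonempty h h')]
  exact Finset.exists_mem_eq_inf' _ _

variable (T α β s) in
/-- If all ones are at `i`, the energy is that of `i` alone. -/
theorem dpValue_self (D : ℝ) (i : Fin n) (y : Fin 2) :
    dpValue T α β D i s y y = α i * (y : ℕ) := by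
  obtain ⟨c, hc, h⟩ := exists_dpValue_eq (T := T) (α := α) (β := β) (i := i) (s := s) D
    (y := y) (t := y) le_rfl (by have := T.size_pos i s; omega)
  obtain ⟨hci, hcount⟩ := mem_configs.1 hc
  rw [count, ← Finset.add_sum_erase _ _ (T.self_mem_nodes i s), hci, Nat.add_eq_left,
    Finset.sum_eq_zero_iff] at hcount
  rw [h, partialEnergy, Finset.sum_eq_zero, add_zero, indicator, hci]
  intro v hv
  simp [indicator, hcount v hv]

/-- Configurations on the two parts of `V(i, s)` can be glued. -/
theorem exists_glue (hs : 1 ≤ s) (hsd : s ≤ T.deg i) (c₁ c₂ : Fin n → Fin 2) :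
    ∃ c : Fin n → Fin 2, (∀ v ∈ T.nodes i (s - 1), c v = c₁ v) ∧
      ∀ v ∈ T.nodes (T.child i s) (T.deg (T.child i s)), c v = c₂ v := by
  classical
  exact ⟨fun v => if v ∈ T.nodes i (s - 1) then c₁ v else c₂ v, fun v hv => if_pos hv,
    fun v hv => if_neg (Finset.disjoint_right.1 (T.disjoint_nodes hs hsd) hv)⟩

/-- The minima satisfy the recursion that merges the `s`-th child into the partial subtree. -/
theorem dpValue_step (D : ℝ) (hs : 1 ≤ s) (hsd : s ≤ T.deg i) (y y' : Fin 2) {a b : ℕ} (ha : y ≤ a)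
    (ha' : a + 1 ≤ T.size i (s - 1) + y) (hb : y' ≤ b)
    (hb' : b + 1 ≤ T.size (T.child i s) (T.deg (T.child i s)) + y') :
    dpValue T α β D i s y (a + b) ≤ dpValue T α β D i (s - 1) y a
      + dpValue T α β D (T.child i s) (T.deg (T.child i s)) y' b
      + β i (T.child i s) * ((y : ℕ) * (y' : ℕ)) := by
  obtain ⟨c₁, hc₁, h₁⟩ := exists_dpValue_eq (T := T) (α := α) (β := β) D ha ha'
  obtain ⟨c₂, hc₂, h₂⟩ := exists_dpValue_eq (T := T) (α := α) (β := β) D hb hb'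
  obtain ⟨c, hg₁, hg₂⟩ := exists_glue hs hsd c₁ c₂
  rw [mem_configs] at hc₁ hc₂
  have hci : c i = y := (hg₁ i (T.self_mem_nodes i _)).trans hc₁.1
  have hcc : c (T.child i s) = y' := (hg₂ _ (T.self_mem_nodes _ _)).trans hc₂.1
  have hc : c ∈ configs T i s y (a + b) := mem_configs.2 ⟨hci, by
    rw [count_step c hs hsd, count_congr hg₁, count_congr hg₂, hc₁.2, hc₂.2]⟩
  refine (dpValue_le hc).trans ?_
  rw [h₁, h₂, partialEnergy_step α β c hs hsd, partialEnergy_congr hg₁, partialEnergy_congr hg₂,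
    indicator, indicator, hci, hcc]

/-- If `(l, α, β)` dominates the indicator of having at least `k` ones, it extends to a feasible
solution of the linear program. -/
theorem exists_feasible {k : ℕ} {l : ℝ}
    (h : ∀ c, (if k ≤ ∑ i, (c i : ℕ) then 1 else 0) ≤ l + configEnergy T c (α, β)) :
    ∃ v : LPVars n, v.Feasible T k ∧ v.lam = l ∧ v.α = α ∧ v.β = β := by
  obtain ⟨τ, Δ, η, γ, χ, hcert⟩ := exists_certificate fun c =>
    le_trans (by split_ifs <;> simp) (h c)
  -- The default value `1 - l` takes care of the counts that no configuration attains, such as `n`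
  -- ones with a zero at the root.
  have hroot : ∀ y, ∀ t ∈ Finset.Icc k n,
      0 ≤ dpValue T α β (1 - l) T.root (T.deg T.root) y t - (1 - l) := by
    intro y t ht
    rw [sub_nonneg, dpValue]
    split_ifs with hne
    · refine Finset.le_inf' _ _ fun c hc => ?_
      have hc := (mem_configs.1 hc).2
      have := h c
      rw [← count_root T c, hc, if_pos (Finset.mem_Icc.1 ht).1] at this
      rw [partialEnergy_root]
      linarith
    · exact le_rfl
  have hself := dpValue_self T α β
  -- The rows of the first child are the case `s = 1` of the general recursion.
  have hfirst : ∀ (i : Fin n) (y y' : Fin 2) (b : ℕ), 1 ≤ T.deg i → y' ≤ b →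
      b + 2 ≤ T.size i 1 + y' → dpValue T α β (1 - l) i 1 y (y + b)
        ≤ α i * (y : ℕ) + dpValue T α β (1 - l) (T.child i 1) (T.deg (T.child i 1)) y' b
          + β i (T.child i 1) * ((y : ℕ) * (y' : ℕ)) := by
    intro i y y' b hd hb hb'
    rw [T.size_step le_rfl hd, T.size_zero] at hb'
    have := dpValue_step (α := α) (β := β) (1 - l) le_rfl hd y y' le_rfl
      (by rw [T.size_zero]; omega) hb (by omega)
    rwa [hself] at this
  have hnext : ∀ (i : Fin n) (s : ℕ) (y y' : Fin 2) (t b : ℕ), s ∈ Finset.Icc 2 (T.deg i) →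
      b ≤ t → y ≤ t - b → t - b + 1 ≤ T.size i (s - 1) + y → y' ≤ b →
      b + 1 ≤ T.size (T.child i s) (T.deg (T.child i s)) + y' →
      dpValue T α β (1 - l) i s y t ≤ dpValue T α β (1 - l) i (s - 1) y (t - b)
        + dpValue T α β (1 - l) (T.child i s) (T.deg (T.child i s)) y' b
        + β i (T.child i s) * ((y : ℕ) * (y' : ℕ)) := by
    intro i s y y' t b hs hbt h1 h2 h3 h4
    rw [Finset.mem_Icc] at hs
    have := dpValue_step (α := α) (β := β) (1 - l) (by omega) hs.2 y y' h1 h2 h3 h4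
    rwa [Nat.sub_add_cancel hbt] at this
  refine ⟨⟨l, 1 - l, α, τ, β, Δ, η, γ, χ, dpValue T α β (1 - l)⟩,
    ⟨hcert.nonneg, hcert.nonneg_τ, hcert.const_row, hcert.node_row, hcert.arc_row, ?_, hroot 0,
      hroot 1, ?_, ?_, ?_, ?_, ?_, ?_, ?_, ?_, ?_, ?_⟩, rfl, rfl, rfl⟩
  · simp
  · intro i s _
    simpa using hself s (1 - l) i 0
  · intro i s _
    simpa using sub_eq_zero.2 (hself s (1 - l) i 1)
  · intro i hd t ht
    rw [Finset.mem_Icc] at ht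
    have hpos := T.size_step le_rfl hd
    have hpos' := T.size_pos (T.child i 1) (T.deg (T.child i 1))
    rw [T.size_zero] at hpos
    have := hfirst i 0 0 t hd (by simp) (by simp; omega)
    simp at this ⊢
    linarith
  · intro i hd t ht
    rw [Finset.mem_Icc] at ht
    have := hfirst i 0 1 t hd (by simp; omega) (by simp; omega)
    simp at this ⊢
    linarith
  · intro i hd t ht
    rw [Finset.mem_Icc] at ht
    have := hfirst i 1 0 (t - 1) hd (by simp) (by simp; omega)
    rw [Fin.val_one, Nat.add_sub_cancel' (by omega)] at this
    simp at this ⊢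
    linarith
  · intro i hd t ht
    rw [Finset.mem_Icc] at ht
    have := hfirst i 1 1 (t - 1) hd (by simp; omega) (by simp; omega)
    rw [Fin.val_one, Nat.add_sub_cancel' (by omega)] at this
    simp at this ⊢
    linarith
  all_goals
    intro i hd s hs t ht b hb
    have hpos := T.size_pos i (s - 1)
    have hpos' := T.size_pos (T.child i s) (T.deg (T.child i s))
    rw [Finset.mem_Icc] at ht hb
  · have := hnext i s 0 0 t b hs (by omega) (by simp) (by simp; omega) (by simp) (by simp; omega)
    simp at this ⊢
    linarith
  · have := hnext i s 0 1 t b hs (by omega) (by simp) (by simp; omega) (by simp; omega)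
      (by simp; omega)
    simp at this ⊢
    linarith
  · have := hnext i s 1 0 t b hs (by omega) (by simp; omega) (by simp; omega) (by simp)
      (by simp; omega)
    simp at this ⊢
    linarith
  · have := hnext i s 1 1 t b hs (by omega) (by simp; omega) (by simp; omega) (by simp; omega)
      (by simp; omega)
    simp at this ⊢
    linarith

end

/-! ### Moments of joint distributions -/

section

variable {n : ℕ} {T : OrderedTree n}

theorem momentWeights_iff {p : Fin n → ℝ} {q : Fin n → Fin n → ℝ} {w : (Fin n → Fin 2) → ℝ} :
    w ∈ momentWeights (configEnergy T) (energy T p q) ↔ w ∈ stdSimplex ℝ (Fin n → Fin 2) ∧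
      (∀ i j, T.Arc i j → ∑ c, w c * (indicator c i * indicator c j) = q i j) ∧
      ∀ i, ∑ c, w c * indicator c i = p i := by
  classical
  refine and_congr_right fun _ => ⟨fun h => ⟨fun i j hij => ?_, fun i => ?_⟩, fun h => ?_⟩
  · have key : ∀ p' q', energy T p' q' (0, Pi.single i (Pi.single j 1)) = q' i j := by
      intro p' q'
      rw [energy_apply, Finset.sum_eq_single (i, j)]
      · simp
      · rintro ⟨a, b⟩ _ hab
        by_cases ha : a = i
        · have hb : b ≠ j := fun hb => hab (by rw [ha, hb])
          simp [ha, hb]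
        · simp [ha]
      · exact fun hn => absurd (T.mem_arcs.2 hij) hn
    have := congrArg (fun F => F (0, Pi.single i (Pi.single j 1))) h
    simpa only [LinearMap.sum_apply, LinearMap.smul_apply, smul_eq_mul, configEnergy, key] using this
  · have key : ∀ p' q', energy T p' q' (Pi.single i 1, 0) = p' i := by
      intro p' q'
      simp [energy_apply, Pi.single_apply]
    have := congrArg (fun F => F (Pi.single i 1, 0)) h
    simpa only [LinearMap.sum_apply, LinearMap.smul_apply, smul_eq_mul, configEnergy, key] using this
  · refine LinearMap.ext fun v => ?_
    simp only [LinearMap.sum_apply, LinearMap.smul_apply, smul_eq_mul, configEnergy, energy_apply,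
      mul_add, Finset.sum_add_distrib, Finset.mul_sum]
    congr 1
    · rw [Finset.sum_comm]
      refine Finset.sum_congr rfl fun i _ => ?_
      rw [← h.2 i, Finset.mul_sum]
      exact Finset.sum_congr rfl fun c _ => by ring
    · rw [Finset.sum_comm]
      refine Finset.sum_congr rfl fun e he => ?_
      rw [← h.1 _ _ (T.mem_arcs.1 he), Finset.mul_sum]
      exact Finset.sum_congr rfl fun c _ => by ring

/-- The configuration that records which entries of a vector are at most `x`. -/
noncomputable def pattern (x : ℝ) (X : Fin n → ℝ) (i : Fin n) : Fin 2 := if X i ≤ x then 1 else 0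

theorem measurable_pattern (x : ℝ) : Measurable (pattern (n := n) x) :=
  measurable_pi_lambda _ fun i => Measurable.ite
    (measurableSet_le (measurable_pi_apply i) measurable_const) measurable_const measurable_const

/-- The `k`-th smallest entry is at most `x` if and only if at least `k` entries are. -/
theorem orderStat_le_iff {k : ℕ} (hk : 1 ≤ k) (hkn : k ≤ n) (X : Fin n → ℝ) (x : ℝ) :
    orderStat k hk hkn X ≤ x ↔ k ≤ ∑ i, (pattern x X i : ℕ) := by
  have h := Tuple.lt_card_le_iff_apply_le_of_monotone (f := X ∘ Tuple.sort X) (a := x)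
    (j := ⟨k - 1, by omega⟩) (Tuple.monotone_sort X)
  have hsum : ∑ i, (pattern x X i : ℕ)
      = (Finset.univ.filter fun i => (X ∘ Tuple.sort X) i ≤ x).card := by
    rw [← Equiv.sum_comp (Tuple.sort X), Finset.card_filter]
    refine Finset.sum_congr rfl fun i _ => ?_
    unfold pattern
    rw [Function.comp_apply]
    split_ifs <;> rfl
  rw [hsum]
  refine Iff.trans h.symm ?_
  simp only
  omega

theorem measureReal_pattern (θ : Measure (Fin n → ℝ)) [IsFiniteMeasure θ] (x : ℝ)
    (P : (Fin n → Fin 2) → Prop) [DecidablePred P] :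
    θ.real {X | P (pattern x X)} = ∑ c, θ.real (pattern x ⁻¹' {c}) * if P c then 1 else 0 := by
  have h := sum_measureReal_preimage_singleton (μ := θ) (Finset.univ.filter P)
    (f := pattern (n := n) x) fun c _ => measurable_pattern x (measurableSet_singleton c)
  simp only [mul_ite, mul_one, mul_zero, ← Finset.sum_filter, h]
  congr 1
  ext X
  simp

/-- Every weight on configurations is induced by a measure with finite support, with entries `x`
and `x + 1`. -/
theorem exists_measure_of_weights (x : ℝ) {w : (Fin n → Fin 2) → ℝ}
    (hw : w ∈ stdSimplex ℝ (Fin n → Fin 2)) :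
    ∃ θ : Measure (Fin n → ℝ), IsProbabilityMeasure θ ∧ ∀ c, θ.real (pattern x ⁻¹' {c}) = w c := by
  classical
  let pt : (Fin n → Fin 2) → Fin n → ℝ := fun c i => if c i = 1 then x else x + 1
  have hpt : ∀ c, pattern x (pt c) = c := by
    intro c
    funext i
    rcases (by omega : c i = 0 ∨ c i = 1) with h | h <;> simp [pattern, pt, h]
  let θ : Measure (Fin n → ℝ) := ∑ c, ENNReal.ofReal (w c) • Measure.dirac (pt c)
  have hθ : ∀ A, MeasurableSet A →
      θ A = ∑ c, ENNReal.ofReal (w c) * A.indicator 1 (pt c) := fun A hA => by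
    simp [θ, Measure.dirac_apply' _ hA]
  refine ⟨θ, ⟨?_⟩, fun c => ?_⟩
  · rw [hθ _ MeasurableSet.univ]
    simp only [Set.indicator_univ, Pi.one_apply, mul_one]
    rw [← ENNReal.ofReal_sum_of_nonneg fun c _ => hw.1 c, hw.2, ENNReal.ofReal_one]
  · rw [Measure.real, hθ _ (measurable_pattern x (measurableSet_singleton c)),
      Finset.sum_eq_single c]
    · simp [hpt, hw.1 c]
    · intro b _ hb
      simp [hpt, hb]
    · simp

/-- Joint distributions with the prescribed probabilities and weights with the prescribed moments
give the same probabilities to the events that depend only on which entries are at most `x`. -/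
theorem jointDistributions_values {k : ℕ} (hk : 1 ≤ k) (hkn : k ≤ n) (x : ℝ) (p : Fin n → ℝ)
    (q : Fin n → Fin n → ℝ) :
    {r | ∃ θ ∈ jointDistributions T x p q, θ.real {X | orderStat k hk hkn X ≤ x} = r}
      = {r | ∃ w ∈ momentWeights (configEnergy T) (energy T p q),
          ∑ c, w c * (if k ≤ ∑ i, (c i : ℕ) then 1 else 0) = r} := by
  have key : ∀ θ : Measure (Fin n → ℝ), IsProbabilityMeasure θ →
      (θ ∈ jointDistributions T x p q ↔
        (fun c => θ.real (pattern x ⁻¹' {c})) ∈ momentWeights (configEnergy T) (energy T p q)) ∧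
      θ.real {X | orderStat k hk hkn X ≤ x}
        = ∑ c, θ.real (pattern x ⁻¹' {c}) * (if k ≤ ∑ i, (c i : ℕ) then 1 else 0) := by
    classical
    intro θ hθ
    have hle : ∀ (X : Fin n → ℝ) i, X i ≤ x ↔ pattern x X i = 1 := fun X i => by
      simp [pattern]
    have hsimplex : (fun c => θ.real (pattern (n := n) x ⁻¹' {c}))
        ∈ stdSimplex ℝ (Fin n → Fin 2) := by
      refine ⟨fun c => measureReal_nonneg, ?_⟩
      simpa using (measureReal_pattern θ x fun _ => True).symm
    have hind : ∀ (c : Fin n → Fin 2) i, indicator c i = if c i = 1 then 1 else 0 := fun c i => by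
      unfold indicator
      generalize c i = a
      fin_cases a <;> simp
    have hind2 : ∀ (c : Fin n → Fin 2) i j,
        indicator c i * indicator c j = if c i = 1 ∧ c j = 1 then 1 else 0 := fun c i j => by
      rw [hind, hind, ite_and]
      split_ifs <;> simp
    constructor
    · rw [momentWeights_iff]
      simp only [jointDistributions, Set.mem_ofPred_eq, hsimplex, hθ, true_and, hle]
      have h1 : ∀ i, θ.real {X | pattern x X i = 1}
          = ∑ c, θ.real (pattern x ⁻¹' {c}) * indicator c i := fun i => by
        rw [measureReal_pattern θ x fun c => c i = 1]
        exact Finset.sum_congr rfl fun c _ => by rw [hind]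
      have h2 : ∀ i j, θ.real {X | pattern x X i = 1 ∧ pattern x X j = 1}
          = ∑ c, θ.real (pattern x ⁻¹' {c}) * (indicator c i * indicator c j) := fun i j => by
        rw [measureReal_pattern θ x fun c => c i = 1 ∧ c j = 1]
        exact Finset.sum_congr rfl fun c _ => by rw [hind2]
      simp only [h1, h2]
    · simp_rw [orderStat_le_iff]
      rw [measureReal_pattern θ x fun c => k ≤ ∑ i, (c i : ℕ)]
  ext r
  constructor
  · rintro ⟨θ, hθ, rfl⟩
    exact ⟨_, (key θ hθ.1).1.1 hθ, (key θ hθ.1).2.symm⟩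
  · rintro ⟨w, hw, rfl⟩
    obtain ⟨θ, hθ, hθw⟩ := exists_measure_of_weights x hw.1
    obtain ⟨h1, h2⟩ := key θ hθ
    simp only [hθw] at h1 h2
    exact ⟨θ, h1.2 hw, h2⟩

theorem Consistent.locallyConsistent {x : ℝ} {p : Fin n → ℝ} {q : Fin n → Fin n → ℝ}
    (h : Consistent T x p q) : LocallyConsistent T p q := by
  refine ⟨fun i => ?_, fun i => ?_, fun i j hij => ?_, fun i j hij => ?_, fun i j hij => ?_,
    fun i j hij => ?_⟩
  · obtain ⟨μ, _, hμ⟩ := h.1 i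
    exact hμ ▸ measureReal_nonneg
  · obtain ⟨μ, _, hμ⟩ := h.1 i
    exact hμ ▸ measureReal_le_one
  all_goals obtain ⟨μ, _, hi, hj, hq⟩ := h.2 i j hij
  · exact hq ▸ measureReal_nonneg
  · rw [← hq, ← hi]
    exact measureReal_mono fun a ha => ha.1
  · rw [← hq, ← hj]
    exact measureReal_mono fun a ha => ha.2
  · have := measureReal_union_add_inter (μ := μ) (s := {a : ℝ × ℝ | a.1 ≤ x})
      (t := {a : ℝ × ℝ | a.2 ≤ x}) (measurableSet_le measurable_snd measurable_const)
    rw [hi, hj] at this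
    rw [← hq]
    have h1 : μ.real ({a : ℝ × ℝ | a.1 ≤ x} ∪ {a : ℝ × ℝ | a.2 ≤ x}) ≤ 1 := measureReal_le_one
    change _ ≤ μ.real ({a : ℝ × ℝ | a.1 ≤ x} ∩ {a : ℝ × ℝ | a.2 ≤ x})
    linarith

end

end TreeBound

theorem proposition4 {n : ℕ} (T : TreeBound.OrderedTree n) (k : ℕ) (hk : 1 ≤ k) (hkn : k ≤ n)
    (x : ℝ) (p : Fin n → ℝ) (q : Fin n → Fin n → ℝ) (hpq : TreeBound.Consistent T x p q) :
    ∃ U : ℝ, TreeBound.IsLPValue T k p q U ∧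
      IsGreatest {r | ∃ θ ∈ TreeBound.jointDistributions T x p q,
        θ.real {X | TreeBound.orderStat k hk hkn X ≤ x} = r} U := by
  open TreeBound in
  -- By Farkas' lemma, the consistent local data extend to a joint distribution.
  have hne : (momentWeights (configEnergy T) (energy T p q)).Nonempty := by
    refine momentWeights_nonempty _ _ fun l v hv => ?_
    obtain ⟨τ, Δ, η, γ, χ, hcert⟩ := exists_certificate hv
    exact hcert.nonneg_energy hpq.locallyConsistent
  obtain ⟨U, hU, l, ⟨α, β⟩, hdom, hle⟩ := moment_duality _ _ hne
    fun c => if k ≤ ∑ i, (c i : ℕ) then 1 else 0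
  obtain ⟨v, hv, rfl, rfl, rfl⟩ := exists_feasible hdom
  have hobj : ∀ u : LPVars n, u.objective T p q = u.lam + energy T p q (u.α, u.β) := fun u => by
    rw [energy_apply, LPVars.objective, add_assoc]
  have hlb : ∀ u : LPVars n, u.Feasible T k → U ≤ u.objective T p q := by
    intro u hu
    obtain ⟨w, hw, rfl⟩ := hU.1
    rw [hobj]
    exact le_of_mem_momentWeights hw hu.indicator_le
  refine ⟨U, ⟨⟨v, hv, le_antisymm ((hobj v).trans_le hle) (hlb v hv)⟩, ?_⟩, ?_⟩
  · rintro _ ⟨u, hu, rfl⟩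
    exact hlb u hu
  · rw [jointDistributions_values]
    exact hU
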